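/- Let $X$ be a complete metric space and let $G$ be a local semiflow on $X$: each $x\in X$ has an escape time $T_x\in(0,\infty]$, the set $\mathcal D=\{(t,x)\in[0,\infty)\times X: t<T_x\}$ is open in $[0,\infty)\times X$, the map $\mathcal D\to X$, $(t,x)\mapsto G(t)x$, is continuous, $G(0)x=x$ for all $x$, and, whenever $t,s\ge 0$ and $t+s<T_x$, $G(t)G(s)x$ is defined and equals $G(t+s)x$. For $J\subset[0,\infty)$ and $M\subset X$ write $G(J)M=\{G(t)x: x\in M,\ t\in J\cap[0,T_x)\}$ and $G(t)M=G(\{t\})M$. A set $M\subset X$ is invariant if $G(t)M=M$ for all $t\ge0$. It is strongly admissible if (i) for all sequences $x_n\in M$ and $t_n\to\infty$ with $t_n<T_{x_n}$ and $G([0,t_n])x_n\subset M$, the sequence $G(t_n)x_n$ has a subsequence converging in $X$; and (ii) $T_x=\infty$ whenever $G([0,T_x))x\subset M$. Let $N,E\subset X$ be closed sets forming a Ważewski pair, that is: (a) for all $x\in N\cap E$ and $t>0$, $G([0,t))x\subset N$ implies $G([0,t))x\subset E$; and (b) for every $x\in N\setminus E$, if $t_{N\setminus E}(x):=\sup\{0\le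 t\le T_x: G([0,t])x\subset N\setminus E\}$ satisfies $t_{N\setminus E}(x)<T_x$, then $G(t_{N\setminus E}(x))x\in E$. Put $H=\overline{N\setminus E}$ and $W=N\cup E$, and assume that $H$ is strongly admissible. Suppose that there are a closed set $L\subset N$ with $L\cap E=\emptyset$, a set $Q\subset W$ and a set $S\subset Q\cap E$ such that $L$ links $Q$ with respect to the family $\Gamma=\{h\in C(Q,W): h|_S=\mathrm{id}_S\}$, that is, $L\cap h(Q)\neq\emptyset$ for every $h\in\Gamma$. Then $\mathcal I(H)\neq\emptyset$, where $\mathcal I(H)$ is the union of all compact invariant sets contained in $H$; in other words, $H$ contains a nonempty compact invariant set. -/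

import Mathlib

open Set Filter Topology
open scoped NNReal ENNReal

/-- A local semiflow on `X`: a continuous map from the open subset
`{(t, x) | t < T x}` of `[0, ∞) × X` to `X`, where `T x ∈ (0, ∞]` is the escape time of `x`.
`flow t x` carries information only when `t < T x`. -/
structure LocalSemiflow (X : Type*) [TopologicalSpace X] where
  /-- the escape time `T x` -/
  T : X → ℝ≥0∞
  /-- the map `G(t)x`, with arbitrary values outside the domain -/
  flow : ℝ≥0 → X → X
  T_pos : ∀ x, 0 < T x
  isOpen_domain : IsOpen {p : ℝ≥0 × X | (p.1 : ℝ≥0∞) < T p.2}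
  continuousOn_flow :
    ContinuousOn (fun p : ℝ≥0 × X => flow p.1 p.2) {p : ℝ≥0 × X | (p.1 : ℝ≥0∞) < T p.2}
  flow_zero : ∀ x, flow 0 x = x
  /-- if `G(t+s)x` is defined, then `G(t)G(s)x` is defined and equals it -/
  flow_add : ∀ (t s : ℝ≥0) (x : X), ((t + s : ℝ≥0) : ℝ≥0∞) < T x →
    (t : ℝ≥0∞) < T (flow s x) ∧ flow (t + s) x = flow t (flow s x)

namespace LocalSemiflow

variable {X : Type*} [TopologicalSpace X] (G : LocalSemiflow X)

/-- `G(J)M = {G(t)x | x ∈ M, t ∈ J ∩ [0, T x)}`. -/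
def img (J : Set ℝ≥0) (M : Set X) : Set X :=
  {y | ∃ x ∈ M, ∃ t ∈ J, (t : ℝ≥0∞) < G.T x ∧ G.flow t x = y}

/-- `M` is invariant: `G(t)M = M` for all `t ≥ 0`. -/
def IsInvariant (M : Set X) : Prop :=
  ∀ t : ℝ≥0, G.img {t} M = M

/-- `G` does not explode in `M`: `T x = ∞` whenever `G([0, T x))x ⊆ M`. -/
def NoExplosion (M : Set X) : Prop :=
  ∀ x, G.img {t | (t : ℝ≥0∞) < G.T x} {x} ⊆ M → G.T x = ∞

/-- `M` is admissible: if `x n ∈ M`, `t n → ∞` and `G([0, t n])(x n) ⊆ M`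
(where `G(t n)(x n)` is defined), then `G(t n)(x n)` has a convergent subsequence. -/
def Admissible (M : Set X) : Prop :=
  ∀ (x : ℕ → X) (t : ℕ → ℝ≥0), (∀ n, x n ∈ M) → Tendsto t atTop atTop →
    (∀ n, (t n : ℝ≥0∞) < G.T (x n)) → (∀ n, G.img (Icc 0 (t n)) {x n} ⊆ M) →
    ∃ (φ : ℕ → ℕ) (y : X), StrictMono φ ∧
      Tendsto (fun k => G.flow (t (φ k)) (x (φ k))) atTop (𝓝 y)

/-- Strong admissibility: admissibility together with non-explosion. -/
def StronglyAdmissible (M : Set X) : Prop :=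
  G.Admissible M ∧ G.NoExplosion M

/-- The escape time in `A`: `t_A(x) = sup {0 ≤ t ≤ T x | G([0, t])x ⊆ A}`. -/
noncomputable def escapeTime (A : Set X) (x : X) : ℝ≥0∞ :=
  sSup {t : ℝ≥0∞ | t ≤ G.T x ∧ G.img {s | (s : ℝ≥0∞) ≤ t} {x} ⊆ A}

/-- `E` is `N`-invariant: for `x ∈ N ∩ E` and `t > 0`, `G([0, t))x ⊆ N` implies
`G([0, t))x ⊆ E`. -/
def RelInvariant (N E : Set X) : Prop :=
  ∀ x ∈ N ∩ E, ∀ t : ℝ≥0, 0 < t → G.img (Ico 0 t) {x} ⊆ N → G.img (Ico 0 t) {x} ⊆ E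

/-- `E` is an exit set of `N`: it is `N`-invariant, and a trajectory starting in `N \ E` whose
escape time `t` in `N \ E` is smaller than `T x` satisfies `G(t)x ∈ E`. -/
def IsExitSet (N E : Set X) : Prop :=
  G.RelInvariant N E ∧
    ∀ x ∈ N \ E, G.escapeTime (N \ E) x < G.T x →
      G.flow (G.escapeTime (N \ E) x).toNNReal x ∈ E

/-- `(N, E)` is a Ważewski pair: both sets are closed and `E` is an exit set of `N`. -/
def IsWazewskiPair (N E : Set X) : Prop :=
  IsClosed N ∧ IsClosed E ∧ G.IsExitSet N E

/-- `𝓘(M)`, the union of all compact invariant sets contained in `M`. -/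
def compactInvariantUnion (M : Set X) : Set X :=
  ⋃₀ {K : Set X | K ⊆ M ∧ IsCompact K ∧ G.IsInvariant K}

end LocalSemiflow

/-- `L` links `Q` with respect to a family `Γ` of continuous maps from `Q` to `X`:
`L ∩ h(Q) ≠ ∅` for all `h ∈ Γ`. -/
def Links {X : Type*} [TopologicalSpace X] (L Q : Set X) (Γ : Set C(Q, X)) : Prop :=
  ∀ h ∈ Γ, (L ∩ range h).Nonempty

/-- The family of continuous maps `Q → W` whose restriction to `S` is the identity. -/
def mapsFixing {X : Type*} [TopologicalSpace X] (Q W S : Set X) : Set C(Q, X) :=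
  {h | (∀ q : Q, h q ∈ W) ∧ ∀ q : Q, (q : X) ∈ S → h q = (q : X)}

/-!
The proof is by contradiction: an orbit that stays in `H = closure (N \ E)` would have a nonempty
compact invariant `ω`-limit set in `H`, by strong admissibility
(`LocalSemiflow.StronglyAdmissible.exists_compact_invariant`). So, if `H` contains no such set, every orbit leaves `H`
in finite time, and so do the nearby orbits, with a common bound on the time spent in `N \ E`.

Since `E` need not be left at once, the exit time from `N \ E` is only lower semicontinuous, and
following the flow up to it does not give a continuous retraction onto `E`. It is enough, however,
to follow the flow for a time between the last visit to `L` and the exit from `N \ E`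
(`LocalSemiflow.pushTimes`). The orbits that enter `E` inside `N` do not meet `L` any more while
they remain in `N`, so the last visit to `L` is upper semicontinuous: the admissible times
form convex sets which locally on `N ∪ E` have a common element
(`LocalSemiflow.IsWazewskiPair.exists_eventually_mem_pushTimes`). A partition of unity then gives a continuous
choice `σ`, vanishing on `E`, and `x ↦ G(σ x) x` is a continuous map of `N ∪ E` into itself
that fixes `E` and misses `L`, which contradicts linking.
-/

namespace LocalSemiflow

variable {X : Type*}

/-! ### Continuity of the flow and orbits staying in a set -/

section Basic

variable [TopologicalSpace X] (G : LocalSemiflow X)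

lemma continuousAt_flow {t : ℝ≥0} {x : X} (h : (t : ℝ≥0∞) < G.T x) :
    ContinuousAt (fun p : ℝ≥0 × X => G.flow p.1 p.2) (t, x) :=
  G.continuousOn_flow.continuousAt (G.isOpen_domain.mem_nhds h)

lemma eventually_lt_T {t : ℝ≥0} {x : X} (h : (t : ℝ≥0∞) < G.T x) :
    ∀ᶠ p : ℝ≥0 × X in 𝓝 (t, x), (p.1 : ℝ≥0∞) < G.T p.2 :=
  G.isOpen_domain.mem_nhds h

lemma continuousAt_flow_time {t : ℝ≥0} {x : X} (h : (t : ℝ≥0∞) < G.T x) :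
    ContinuousAt (fun s => G.flow s x) t :=
  (G.continuousAt_flow h).comp (f := fun s : ℝ≥0 => (s, x)) (by fun_prop)

lemma continuousAt_flow_space {t : ℝ≥0} {x : X} (h : (t : ℝ≥0∞) < G.T x) :
    ContinuousAt (fun y => G.flow t y) x :=
  (G.continuousAt_flow h).comp (f := fun y : X => (t, y)) (by fun_prop)

/-- `G([0, t])x` is defined and contained in `A`. -/
def StaysIn (A : Set X) (x : X) (t : ℝ≥0) : Prop :=
  (t : ℝ≥0∞) < G.T x ∧ ∀ r ≤ t, G.flow r x ∈ A

variable {G}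

lemma StaysIn.mono {A B : Set X} {x : X} {s t : ℝ≥0} (h : G.StaysIn A x t) (hst : s ≤ t)
    (hAB : A ⊆ B) : G.StaysIn B x s :=
  ⟨(ENNReal.coe_le_coe.2 hst).trans_lt h.1, fun r hr => hAB (h.2 r (hr.trans hst))⟩

lemma staysIn_zero {A : Set X} {x : X} (hx : x ∈ A) : G.StaysIn A x 0 :=
  ⟨G.T_pos x, fun r hr => by rwa [nonpos_iff_eq_zero.1 hr, G.flow_zero]⟩

end Basic

/-! ### Limit sets of orbits staying in a strongly admissible set -/

section Omega

/-- The `ω`-limit set of `x`, described by sequences of times. -/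
def omega [TopologicalSpace X] (G : LocalSemiflow X) (x : X) : Set X :=
  {y | ∃ t : ℕ → ℝ≥0, Tendsto t atTop atTop ∧ Tendsto (fun n => G.flow (t n) x) atTop (𝓝 y)}

variable [MetricSpace X] {G : LocalSemiflow X} {H : Set X} {x : X}

lemma StronglyAdmissible.T_eq_top (hH : G.StronglyAdmissible H)
    (hx : ∀ t : ℝ≥0, (t : ℝ≥0∞) < G.T x → G.flow t x ∈ H) : G.T x = ∞ := by
  refine hH.2 x ?_
  rintro _ ⟨_, rfl, t, ht, -, rfl⟩
  exact hx t ht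

lemma StronglyAdmissible.exists_subseq (hH : G.StronglyAdmissible H)
    (hx : ∀ t : ℝ≥0, (t : ℝ≥0∞) < G.T x → G.flow t x ∈ H) {t : ℕ → ℝ≥0}
    (ht : Tendsto t atTop atTop) :
    ∃ (φ : ℕ → ℕ) (y : X), StrictMono φ ∧
      Tendsto (fun k => G.flow (t (φ k)) x) atTop (𝓝 y) := by
  refine hH.1 (fun _ => x) t (fun _ => ?_) ht (fun n => ?_) (fun n => ?_)
  · simpa only [G.flow_zero] using hx 0 (G.T_pos x)
  · simp [hH.T_eq_top hx]
  · rintro _ ⟨_, rfl, s, -, hs, rfl⟩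
    exact hx s hs

lemma omega_subset (hHc : IsClosed H) (hT : G.T x = ∞)
    (hx : ∀ t : ℝ≥0, (t : ℝ≥0∞) < G.T x → G.flow t x ∈ H) : G.omega x ⊆ H := by
  rintro y ⟨t, -, hy⟩
  exact hHc.mem_of_tendsto hy (Eventually.of_forall fun n => hx _ (by simp [hT]))

lemma flow_mem_omega (hT : G.T x = ∞) {y : X} (hy : y ∈ G.omega x) {t : ℝ≥0}
    (ht : (t : ℝ≥0∞) < G.T y) : G.flow t y ∈ G.omega x := by
  obtain ⟨s, hs, hy⟩ := hy
  refine ⟨fun n => t + s n, tendsto_atTop_mono (fun n => le_add_of_nonneg_left zero_le) hs, ?_⟩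
  refine ((G.continuousAt_flow_space ht).tendsto.comp hy).congr fun n => ?_
  exact (G.flow_add t (s n) x (by simp [hT])).2.symm

lemma StronglyAdmissible.isCompact_omega (hH : G.StronglyAdmissible H)
    (hx : ∀ t : ℝ≥0, (t : ℝ≥0∞) < G.T x → G.flow t x ∈ H) : IsCompact (G.omega x) := by
  refine IsSeqCompact.isCompact fun y hy => ?_
  have key : ∀ k : ℕ, ∃ t : ℝ≥0, (k : ℝ≥0) ≤ t ∧ dist (G.flow t x) (y k) < 1 / ((k : ℝ) + 1) := by
    intro k
    obtain ⟨t, ht, hty⟩ := hy k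
    obtain ⟨n, h₁, h₂⟩ := ((ht.eventually_ge_atTop (k : ℝ≥0)).and
      (hty.eventually (Metric.ball_mem_nhds (y k) (Nat.one_div_pos_of_nat (n := k))))).exists
    exact ⟨t n, h₁, h₂⟩
  choose t ht hty using key
  have htt : Tendsto t atTop atTop := tendsto_atTop_mono ht tendsto_natCast_atTop_atTop
  obtain ⟨φ, z, hφ, hz⟩ := hH.exists_subseq hx htt
  refine ⟨z, ⟨t ∘ φ, htt.comp hφ.tendsto_atTop, hz⟩, φ, hφ, ?_⟩
  refine hz.congr_dist ?_
  exact squeeze_zero (fun _ => dist_nonneg) (fun k => (hty (φ k)).le)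
    (tendsto_one_div_add_atTop_nhds_zero_nat.comp hφ.tendsto_atTop)

/-- Backward invariance comes from shifting the times by `t` and passing to a further limit point,
whose escape time is infinite because its orbit stays in `H`. -/
lemma StronglyAdmissible.isInvariant_omega (hHc : IsClosed H) (hH : G.StronglyAdmissible H)
    (hx : ∀ t : ℝ≥0, (t : ℝ≥0∞) < G.T x → G.flow t x ∈ H) : G.IsInvariant (G.omega x) := by
  have hT := hH.T_eq_top hx
  intro t
  refine Subset.antisymm ?_ ?_
  · rintro _ ⟨y, hy, _, rfl, ht, rfl⟩
    exact flow_mem_omega hT hy ht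
  · rintro y ⟨s, hs, hy⟩
    have hs' : Tendsto (fun n => s n - t) atTop atTop := by
      refine tendsto_atTop.2 fun b => ?_
      filter_upwards [hs.eventually_ge_atTop (b + t)] with n hn using le_tsub_of_add_le_right hn
    obtain ⟨φ, z, hφ, hz⟩ := hH.exists_subseq hx hs'
    have hzω : z ∈ G.omega x := ⟨_, hs'.comp hφ.tendsto_atTop, hz⟩
    have hzT : G.T z = ∞ := hH.T_eq_top fun r hr =>
      omega_subset hHc hT hx (flow_mem_omega hT hzω hr)
    have htz : (t : ℝ≥0∞) < G.T z := by simp [hzT]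
    refine ⟨z, hzω, t, rfl, htz, ?_⟩
    refine tendsto_nhds_unique ((G.continuousAt_flow_space htz).tendsto.comp hz) ?_
    refine (hy.comp hφ.tendsto_atTop).congr' ?_
    filter_upwards [(hs.comp hφ.tendsto_atTop).eventually_ge_atTop t] with n hn
    have hn : t ≤ s (φ n) := hn
    have := (G.flow_add t (s (φ n) - t) x (by rw [hT]; exact ENNReal.coe_lt_top)).2
    rw [add_tsub_cancel_of_le hn] at this
    exact this

lemma StronglyAdmissible.exists_compact_invariant (hHc : IsClosed H)
    (hH : G.StronglyAdmissible H)
    (hx : ∀ t : ℝ≥0, (t : ℝ≥0∞) < G.T x → G.flow t x ∈ H) :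
    (G.compactInvariantUnion H).Nonempty := by
  obtain ⟨φ, y, hφ, hy⟩ := hH.exists_subseq hx
    (t := fun n : ℕ => (n : ℝ≥0)) tendsto_natCast_atTop_atTop
  have hyω : y ∈ G.omega x :=
    ⟨_, tendsto_natCast_atTop_atTop.comp hφ.tendsto_atTop, hy⟩
  exact ⟨y, G.omega x, ⟨omega_subset hHc (hH.T_eq_top hx) hx, hH.isCompact_omega hx,
    hH.isInvariant_omega hHc hx⟩, hyω⟩

end Omega

/-! ### Orbits of a Ważewski pair -/

section Wazewski

variable [TopologicalSpace X] {G : LocalSemiflow X} {N E L : Set X} {x : X}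

/-- An orbit in `N` that starts in `E` remains in `E`, at its final time as well since `E` is
closed. -/
lemma IsWazewskiPair.flow_mem_exit (h : G.IsWazewskiPair N E) (hx : x ∈ E) {t : ℝ≥0}
    (ht : G.StaysIn N x t) : G.flow t x ∈ E := by
  rcases eq_zero_or_pos t with rfl | hpos
  · rwa [G.flow_zero]
  have hxN : x ∈ N := by simpa only [G.flow_zero] using ht.2 0 zero_le
  have hsub : G.img (Ico 0 t) {x} ⊆ E := by
    refine h.2.2.1 x ⟨hxN, hx⟩ t hpos ?_
    rintro _ ⟨_, rfl, s, hs, -, rfl⟩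
    exact ht.2 s hs.2.le
  have hmem : t ∈ closure (Iio t) := by
    rw [closure_Iio' (a := t) ⟨0, hpos⟩]; exact self_mem_Iic
  have : (𝓝[<] t).NeBot := mem_closure_iff_nhdsWithin_neBot.1 hmem
  refine h.2.1.mem_of_tendsto ((G.continuousAt_flow_time ht.1).tendsto.mono_left
    (nhdsWithin_le_nhds (s := Iio t))) ?_
  filter_upwards [self_mem_nhdsWithin] with s hs
  exact hsub ⟨x, rfl, s, ⟨zero_le, hs⟩,
    (ENNReal.coe_lt_coe.2 hs).trans ht.1, rfl⟩

/-- An orbit leaves `N \ E` only through `E`. -/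
lemma IsWazewskiPair.exists_exit (h : G.IsWazewskiPair N E) (hx : x ∈ N \ E) {s : ℝ≥0}
    (hs : (s : ℝ≥0∞) < G.T x) (hsx : G.flow s x ∉ N \ E) :
    ∃ t ≤ s, (∀ r < t, G.flow r x ∈ N \ E) ∧ G.flow t x ∈ E := by
  have hle : G.escapeTime (N \ E) x ≤ s := by
    refine sSup_le fun u hu => le_of_not_gt fun hlt => hsx ?_
    exact hu.2 ⟨x, rfl, s, hlt.le, hs, rfl⟩
  have hcoe : ((G.escapeTime (N \ E) x).toNNReal : ℝ≥0∞) = G.escapeTime (N \ E) x :=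
    ENNReal.coe_toNNReal (hle.trans_lt ENNReal.coe_lt_top).ne
  refine ⟨(G.escapeTime (N \ E) x).toNNReal, ?_, fun r hr => ?_,
    h.2.2.2 x hx (hle.trans_lt hs)⟩
  · rwa [← ENNReal.coe_le_coe, hcoe]
  · rw [← ENNReal.coe_lt_coe, hcoe] at hr
    obtain ⟨u, hu, hru⟩ := lt_sSup_iff.1 hr
    exact hu.2 ⟨x, rfl, r, hru.le, hru.trans_le hu.1, rfl⟩

/-- The times between the last visit of the orbit of `x` to `L` and its exit from `N \ E`, for
`x ∉ E`; only the time `0` for `x ∈ E`. They are real numbers, so that convexity makes sense. -/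
def pushTimes (G : LocalSemiflow X) (N E L : Set X) (x : X) : Set ℝ :=
  {c | 0 ≤ c ∧ (x ∈ E → c = 0) ∧ (x ∉ E → G.StaysIn (N \ E) x c.toNNReal ∧
    ∀ t, c.toNNReal ≤ t → G.StaysIn (N \ E) x t → G.flow t x ∉ L)}

lemma convex_pushTimes : Convex ℝ (G.pushTimes N E L x) := by
  refine OrdConnected.convex ⟨fun a ha b hb c hc => ⟨ha.1.trans hc.1, fun hx => ?_, fun hx => ?_⟩⟩
  · exact le_antisymm (hc.2.trans (hb.2.1 hx).le) (ha.1.trans hc.1)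
  · exact ⟨(hb.2.2 hx).1.mono (Real.toNNReal_le_toNNReal hc.2) le_rfl,
      fun t ht => (ha.2.2 hx).2 t ((Real.toNNReal_le_toNNReal hc.1).trans ht)⟩

/-- Upper semicontinuity of the last visit to `L`: if the orbit of `x` leaves `closure (N \ E)`
and does not visit `L` after time `c` while in `N`, then the same bound `c` holds for the orbits of
the nearby points while they are in `N \ E`. -/
lemma eventually_flow_notMem (hN : IsClosed N) (hL : IsClosed L) {c s : ℝ≥0}
    (hs : (s : ℝ≥0∞) < G.T x) (hsx : G.flow s x ∉ closure (N \ E))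
    (hc : ∀ t, c ≤ t → G.StaysIn N x t → G.flow t x ∉ L) :
    ∀ᶠ y in 𝓝 x, ∀ t, c ≤ t → G.StaysIn (N \ E) y t → G.flow t y ∉ L := by
  have hexit : ∀ᶠ y in 𝓝 x, G.flow s y ∉ closure (N \ E) :=
    (G.continuousAt_flow_space hs).eventually (isClosed_closure.isOpen_compl.mem_nhds hsx)
  have hcpt : ∀ᶠ y in 𝓝 x, ∀ t ∈ Icc c s, ¬ (G.StaysIn N y t ∧ G.flow t y ∈ L) := by
    refine (isCompact_Icc).eventually_forall_of_forall_eventually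
      (P := fun y t => ¬ (G.StaysIn N y t ∧ G.flow t y ∈ L)) fun t ht => ?_
    have htT : (t : ℝ≥0∞) < G.T x := (ENNReal.coe_le_coe.2 ht.2).trans_lt hs
    have hflow : ContinuousAt (fun z : X × ℝ≥0 => G.flow z.2 z.1) (x, t) := by
      have hswap : ContinuousAt (fun z : X × ℝ≥0 => (z.2, z.1)) (x, t) := by fun_prop
      exact (G.continuousAt_flow htT).comp (f := fun z : X × ℝ≥0 => (z.2, z.1)) hswap
    by_cases hst : G.StaysIn N x t
    · filter_upwards [hflow.eventually (hL.isOpen_compl.mem_nhds (hc t ht.1 hst))] with z hz hz'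
      exact hz hz'.2
    · obtain ⟨r, hrt, hr⟩ : ∃ r ≤ t, G.flow r x ∉ N := by
        by_contra! hcon
        exact hst ⟨htT, hcon⟩
      rcases hrt.eq_or_lt with rfl | hlt
      · filter_upwards [hflow.eventually (hN.isOpen_compl.mem_nhds hr)] with z hz hz'
        exact hz (hz'.1.2 _ le_rfl)
      · have hrc : ContinuousAt (fun z : X × ℝ≥0 => G.flow r z.1) (x, t) :=
          (G.continuousAt_flow_space ((ENNReal.coe_lt_coe.2 hlt).trans htT)).comp
            (f := fun z : X × ℝ≥0 => z.1) (by fun_prop)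
        filter_upwards [hrc.eventually (hN.isOpen_compl.mem_nhds hr),
          (continuousAt_snd (p := (x, t))).eventually (lt_mem_nhds hlt)] with z hz hrz hz'
        exact hz (hz'.1.2 _ hrz.le)
  filter_upwards [hexit, hcpt] with y hy hy' t hct hty hmem
  have hts : t ≤ s := le_of_not_gt fun hst => hy (subset_closure (hty.2 s hst.le))
  exact hy' t ⟨hct, hts⟩ ⟨hty.mono le_rfl sdiff_subset, hmem⟩

/-- The time for which an orbit stays in `N \ E` is lower semicontinuous on `N \ E`. -/
lemma IsWazewskiPair.eventually_staysIn (h : G.IsWazewskiPair N E) {c : ℝ≥0}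
    (hc : G.StaysIn (N \ E) x c) :
    ∀ᶠ y in 𝓝 x, y ∈ N \ E → G.StaysIn (N \ E) y c := by
  have hcpt : ∀ᶠ y in 𝓝 x, ∀ t ∈ Icc (0 : ℝ≥0) c, (t : ℝ≥0∞) < G.T y ∧ G.flow t y ∉ E := by
    refine (isCompact_Icc).eventually_forall_of_forall_eventually
      (P := fun (y : X) (t : ℝ≥0) => (t : ℝ≥0∞) < G.T y ∧ G.flow t y ∉ E) fun t ht => ?_
    have htT : (t : ℝ≥0∞) < G.T x := (hc.mono ht.2 le_rfl).1
    have hswap : ContinuousAt (fun z : X × ℝ≥0 => (z.2, z.1)) (x, t) := by fun_prop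
    have hflow : ContinuousAt (fun z : X × ℝ≥0 => G.flow z.2 z.1) (x, t) :=
      ContinuousAt.comp (g := fun p : ℝ≥0 × X => G.flow p.1 p.2)
        (f := fun z : X × ℝ≥0 => (z.2, z.1)) (G.continuousAt_flow htT) hswap
    exact (hswap.eventually (G.eventually_lt_T htT)).and
      (hflow.eventually (h.2.1.isOpen_compl.mem_nhds (hc.2 t ht.2).2))
  filter_upwards [hcpt] with y hy hyNE
  refine ⟨(hy c ⟨zero_le, le_rfl⟩).1, fun r hr => ?_⟩
  by_contra hcon
  obtain ⟨t, htr, -, htE⟩ := h.exists_exit hyNE (hy r ⟨zero_le, hr⟩).1 hcon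
  exact (hy t ⟨zero_le, htr.trans hr⟩).2 htE

/-- If `x ∈ N \ E` leaves `N \ E`, then at some earlier time it has made its last visit to `L`
within `N`. -/
lemma IsWazewskiPair.exists_last_visit (h : G.IsWazewskiPair N E) (hL : IsClosed L)
    (hLE : Disjoint L E) (hx : x ∈ N \ E) {s : ℝ≥0} (hs : (s : ℝ≥0∞) < G.T x)
    (hsx : G.flow s x ∉ N \ E) :
    ∃ c, G.StaysIn (N \ E) x c ∧ ∀ t, c ≤ t → G.StaysIn N x t → G.flow t x ∉ L := by
  obtain ⟨τ, hτs, hτ, hτE⟩ := h.exists_exit hx hs hsx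
  have hτT : (τ : ℝ≥0∞) < G.T x := (ENNReal.coe_le_coe.2 hτs).trans_lt hs
  have hτ0 : 0 < τ := pos_iff_ne_zero.2 fun h0 => hx.2 (by simpa [h0, G.flow_zero] using hτE)
  have hev : ∀ᶠ t in 𝓝 τ, G.flow t x ∉ L :=
    (G.continuousAt_flow_time hτT).eventually
      (hL.isOpen_compl.mem_nhds fun hm => hLE.le_bot ⟨hm, hτE⟩)
  obtain ⟨c, hcτ, hc⟩ := exists_Ioc_subset_of_mem_nhds hev ⟨0, hτ0⟩
  obtain ⟨d, hcd, hdτ⟩ := exists_between hcτ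
  refine ⟨d, ⟨(ENNReal.coe_lt_coe.2 hdτ).trans hτT, fun r hr => hτ r (hr.trans_lt hdτ)⟩,
    fun t hdt ht => ?_⟩
  rcases le_or_gt t τ with htτ | hτt
  · exact hc ⟨hcd.trans_le hdt, htτ⟩
  -- After the exit time the orbit remains in `E` as long as it is in `N`.
  have hadd : t - τ + τ = t := tsub_add_cancel_of_le hτt.le
  have hE : G.flow (t - τ) (G.flow τ x) ∈ E := by
    refine h.flow_mem_exit hτE ⟨(G.flow_add _ _ _ (by rw [hadd]; exact ht.1)).1, fun r hr => ?_⟩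
    have hrt : r + τ ≤ t := by rw [← hadd]; gcongr
    rw [← (G.flow_add _ _ _ ((ENNReal.coe_le_coe.2 hrt).trans_lt ht.1)).2]
    exact ht.2 _ hrt
  rw [← (G.flow_add _ _ _ (by rw [hadd]; exact ht.1)).2, hadd] at hE
  exact fun hm => hLE.le_bot ⟨hm, hE⟩

/-- Near each point of `N ∪ E` there is a common push time. -/
lemma IsWazewskiPair.exists_eventually_mem_pushTimes (h : G.IsWazewskiPair N E)
    (hL : IsClosed L) (hLE : Disjoint L E)
    (hexit : ∀ x, ∃ t : ℝ≥0, (t : ℝ≥0∞) < G.T x ∧ G.flow t x ∉ closure (N \ E)) (x : X) :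
    ∃ c : ℝ, ∀ᶠ y in 𝓝 x, y ∈ N ∪ E → c ∈ G.pushTimes N E L y := by
  obtain ⟨s, hs, hsx⟩ := hexit x
  by_cases hxE : x ∈ E
  · refine ⟨0, ?_⟩
    have hno : ∀ t, 0 ≤ t → G.StaysIn N x t → G.flow t x ∉ L :=
      fun t _ ht hm => hLE.le_bot ⟨hm, h.flow_mem_exit hxE ht⟩
    filter_upwards [eventually_flow_notMem h.1 hL hs hsx hno] with y hy hyW
    refine ⟨le_rfl, fun _ => rfl, fun hyE => ?_⟩
    rw [Real.toNNReal_zero]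
    exact ⟨staysIn_zero ⟨hyW.resolve_right hyE, hyE⟩, hy⟩
  by_cases hxN : x ∈ N
  · obtain ⟨c, hc, hcL⟩ := h.exists_last_visit hL hLE ⟨hxN, hxE⟩ hs fun hm => hsx (subset_closure hm)
    refine ⟨c, ?_⟩
    filter_upwards [eventually_flow_notMem h.1 hL hs hsx hcL, h.eventually_staysIn hc,
      h.2.1.isOpen_compl.mem_nhds hxE] with y hy hyc hyE hyW
    refine ⟨c.2, fun hyE' => absurd hyE' hyE, fun _ => ?_⟩
    rw [Real.toNNReal_coe]
    exact ⟨hyc ⟨hyW.resolve_right hyE, hyE⟩, hy⟩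
  · refine ⟨0, ?_⟩
    filter_upwards [h.1.isOpen_compl.mem_nhds hxN, h.2.1.isOpen_compl.mem_nhds hxE] with y h₁ h₂ h₃
    exact absurd h₃ (not_or.2 ⟨h₁, h₂⟩)

end Wazewski

/-- Following the flow for a push time chosen continuously gives a map of `N ∪ E` into itself which
fixes `E` and misses `L`. -/
lemma IsWazewskiPair.exists_continuousMap [MetricSpace X] {G : LocalSemiflow X} {N E L : Set X}
    (h : G.IsWazewskiPair N E) (hL : IsClosed L) (hLE : Disjoint L E)
    (hexit : ∀ x, ∃ t : ℝ≥0, (t : ℝ≥0∞) < G.T x ∧ G.flow t x ∉ closure (N \ E)) :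
    ∃ f : C((N ∪ E : Set X), X), ∀ x, f x ∈ N ∪ E ∧ f x ∉ L ∧ ((x : X) ∈ E → f x = x) := by
  obtain ⟨σ, hσ⟩ := exists_continuous_forall_mem_convex_of_local_const
    (X := (N ∪ E : Set X)) (t := fun x => G.pushTimes N E L x) (fun _ => convex_pushTimes)
    (fun x => by
      obtain ⟨c, hc⟩ := h.exists_eventually_mem_pushTimes hL hLE hexit x
      refine ⟨c, ?_⟩
      filter_upwards [continuousAt_subtype_val.eventually hc] with y hy using hy y.2)
  have hfix : ∀ x : (N ∪ E : Set X), (x : X) ∈ E → G.flow (σ x).toNNReal x = x := fun x hx => by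
    rw [(hσ x).2.1 hx, Real.toNNReal_zero, G.flow_zero]
  have hT : ∀ x : (N ∪ E : Set X), ((σ x).toNNReal : ℝ≥0∞) < G.T x := fun x => by
    by_cases hx : (x : X) ∈ E
    · rw [(hσ x).2.1 hx, Real.toNNReal_zero]; exact G.T_pos x
    · exact ((hσ x).2.2 hx).1.1
  refine ⟨⟨fun x => G.flow (σ x).toNNReal x, continuous_iff_continuousAt.2 fun x => ?_⟩,
    fun x => ⟨?_, ?_, hfix x⟩⟩
  · exact (G.continuousAt_flow (hT x)).comp
      (f := fun x : (N ∪ E : Set X) => ((σ x).toNNReal, (x : X)))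
      (Continuous.continuousAt (by fun_prop))
  · by_cases hx : (x : X) ∈ E
    · exact Or.inr (by simpa only [ContinuousMap.coe_mk, hfix x hx] using hx)
    · exact Or.inl (((hσ x).2.2 hx).1.2 _ le_rfl).1
  · by_cases hx : (x : X) ∈ E
    · have hxL : (x : X) ∉ L := fun hm => hLE.le_bot ⟨hm, hx⟩
      simpa only [ContinuousMap.coe_mk, hfix x hx] using hxL
    · exact ((hσ x).2.2 hx).2 _ le_rfl ((hσ x).2.2 hx).1

end LocalSemiflow

/-! ### Linking and compact invariant sets -/

theorem theorem4p2 {X : Type*} [MetricSpace X] [CompleteSpace X] (G : LocalSemiflow X)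
    (N E : Set X) (hNE : G.IsWazewskiPair N E)
    (hH : G.StronglyAdmissible (closure (N \ E)))
    (L Q S : Set X) (hL : IsClosed L) (hLN : L ⊆ N) (hLE : L ∩ E = ∅)
    (hQ : Q ⊆ N ∪ E) (hS : S ⊆ Q ∩ E)
    (hlink : Links L Q (mapsFixing Q (N ∪ E) S)) :
    (G.compactInvariantUnion (closure (N \ E))).Nonempty := by
  by_contra hcon
  have hexit : ∀ x, ∃ t : ℝ≥0, (t : ℝ≥0∞) < G.T x ∧ G.flow t x ∉ closure (N \ E) := by
    intro x
    by_contra! hx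
    exact hcon (hH.exists_compact_invariant isClosed_closure hx)
  obtain ⟨f, hf⟩ := hNE.exists_continuousMap hL (disjoint_iff_inter_eq_empty.2 hLE) hexit
  obtain ⟨_, hmem, q, rfl⟩ := hlink (f.comp ⟨inclusion hQ, continuous_inclusion hQ⟩)
    ⟨fun q => (hf _).1, fun q hq => (hf _).2.2 (hS hq).2⟩
  exact (hf _).2.1 hmem
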